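/- Let $N>1$, $m\in\mathbb N$, $p>1$, and let $\Omega\subset\mathbb R^N$ be a bounded domain. Write $W_0^{1,p}(\Omega)=W_0^{1,p}(\Omega;\mathbb R^m)$, normed by $\|v\|=\big(\int_\Omega|Dv|^p\big)^{1/p}$ with $|\cdot|$ the Euclidean norm on $\mathbb R^{m\times N}$, and $W^{-1,p'}(\Omega)$ for its dual. Let $A:\Omega\times\mathbb R^m\to\mathbb R$ be a $C^1$-Carathéodory function (measurable in $x$ for every $s$, of class $C^1$ in $s$ for a.e. $x$), and suppose that there are constants $C_0$ and $\nu_0>0$ such that, for a.e. $x\in\Omega$ and every $s\in\mathbb R^m$, - (a.1) $|A(x,s)|\le C_0$ and $|\nabla_sA(x,s)|\le C_0$; - (a.2) $A(x,s)\ge\nu_0$; - (a.3) $s\cdot\nabla_sA(x,s)\ge0$. Let $G:\Omega\times\mathbb R^m\to\mathbb R$ be a $C^1$-Carathéodory function with $G(x,0)=0$ and $\nabla_sG(x,0)=0$ for a.e. $x\in\Omega$, whose gradient $g=\nabla_sG$ satisfies, for a.e. $x\in\Omega$ and every $s\in\mathbb R^m$, - (g.1) $|g(x,s)|\le a(x)+b|s|^{q-1}$,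 where $b\ge0$, $a\in L^r(\Omega)$, $r\in[1,\infty]$ with $r\ge\frac{Np}{Np-N+p}$ if $N>p$ and $r\ge1$ if $N\le p$, and $p<q<p^*$, with $p^*=\frac{Np}{N-p}$ if $N>p$ and $p^*=+\infty$ if $N\le p$. Put $$\mathcal J(u)=\frac1p\int_\Omega A(x,u)|Du|^p\,dx-\int_\Omega G(x,u)\,dx ,$$ and let $(u_n)\subset W_0^{1,p}(\Omega)$ be a Concrete Palais–Smale (CPS) sequence for $\mathcal J$ at some level $c\in\mathbb R$. That is, $\mathcal J(u_n)$ is well defined for every $n$, with $G(\cdot,u_n)\in L^1(\Omega)$ (automatic unless $p=N$ and $r=1$), $\mathcal J(u_n)\to c$, and the distributions $$\omega_n=-\operatorname{div}\big(A(x,u_n)|Du_n|^{p-2}Du_n\big)+\tfrac1p\nabla_sA(x,u_n)|Du_n|^p-g(x,u_n)$$ belong to $W^{-1,p'}(\Omega)$ and satisfy $\omega_n\to0$ in $W^{-1,p'}(\Omega)$. Then for every $R>0$ and every $\varepsilon>0$ there is a constant $K=K(R,\varepsilon)>0$ such that, for every $n\in\mathbb N$, $$\int_{\{|u_n|\le R\}}A(x,u_n)|Du_n|^p\,dx\le\varepsilon\int_{\{|u_n|\ge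 R\}}A(x,u_n)|Du_n|^p\,dx+K .$$ -/

import Mathlib

open MeasureTheory Filter Topology Distributions TopologicalSpace
open scoped ENNReal

/-- Points of `ℝ^d` with the Euclidean norm. -/
abbrev Euc (d : ℕ) : Type := EuclideanSpace ℝ (Fin d)

/-- Real `m × N` matrices (given by their rows) with the Euclidean (Frobenius) inner product
`M · M' = ∑ i j, M i j * M' i j` and the corresponding norm. -/
abbrev Mat (m N : ℕ) : Type := PiLp 2 (fun _ : Fin m => EuclideanSpace ℝ (Fin N))

/-- The classical Jacobian matrix; its `i`-th row is the gradient of the `i`-th component. -/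
noncomputable def jacobian {N m : ℕ} (v : Euc N → Euc m) (x : Euc N) : Mat m N :=
  WithLp.toLp 2 fun i => gradient (fun y => v y i) x

/-- `Du` is a weak (distributional) Jacobian matrix of `u` in `Ω`. -/
def IsWeakJacobian {N m : ℕ} (Ω : Opens (Euc N)) (u : Euc N → Euc m)
    (Du : Euc N → Mat m N) : Prop :=
  ∀ (φ : 𝓓(Ω, ℝ)) (i : Fin m) (j : Fin N),
    ∫ x in (Ω : Set (Euc N)), u x i * gradient φ x j
      = -∫ x in (Ω : Set (Euc N)), Du x i j * φ x

/-- The Sobolev space `W_0^{1,p}(Ω; ℝ^m)`, the closure of `C_c^∞(Ω; ℝ^m)` in `W^{1,p}(Ω; ℝ^m)`.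
An element is a function `u ∈ L^p` together with its weak Jacobian `Du ∈ L^p` (both given by
representatives; their values outside `Ω` are irrelevant), approximable by test functions in the
`W^{1,p}` norm. -/
structure SobolevZero {N : ℕ} (Ω : Opens (Euc N)) (m : ℕ) (p : ℝ) where
  toFun : Euc N → Euc m
  jac : Euc N → Mat m N
  memLp : MemLp toFun (ENNReal.ofReal p) (volume.restrict Ω)
  memLp_jac : MemLp jac (ENNReal.ofReal p) (volume.restrict Ω)
  isWeakJacobian : IsWeakJacobian Ω toFun jac
  approx : ∀ ε : ℝ≥0∞, 0 < ε → ∃ φ : 𝓓(Ω, Euc m),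
    eLpNorm (fun x => toFun x - φ x) (ENNReal.ofReal p) (volume.restrict Ω) < ε ∧
    eLpNorm (fun x => jac x - jacobian φ x) (ENNReal.ofReal p) (volume.restrict Ω) < ε

/-- `F : Ω × ℝ^m → ℝ` is a `C^1`-Carathéodory function: measurable in `x` for every `s`, and of
class `C^1` in `s` for almost every `x ∈ Ω`. -/
def IsC1Caratheodory {N m : ℕ} (Ω : Opens (Euc N)) (F : Euc N → Euc m → ℝ) : Prop :=
  (∀ s : Euc m, AEMeasurable (fun x => F x s) (volume.restrict Ω)) ∧
  ∀ᵐ x ∂(volume.restrict (Ω : Set (Euc N))), ContDiff ℝ 1 (F x)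

/-- The norm in `W^{-1,p'}(Ω; ℝ^m)`, the dual of `W_0^{1,p}(Ω; ℝ^m)` normed by `‖Dv‖_{L^p}`, of a
linear functional `T` on test functions; it is `∞` when `T` does not extend continuously to
`W_0^{1,p}`. -/
noncomputable def dualNorm {N m : ℕ} (Ω : Opens (Euc N)) (p : ℝ) (T : 𝓓(Ω, Euc m) → ℝ) : ℝ≥0∞ :=
  ⨆ (v : 𝓓(Ω, Euc m))
    (_ : eLpNorm (jacobian v) (ENNReal.ofReal p) (volume.restrict Ω) ≤ 1), ENNReal.ofReal |T v|

section Functional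

variable {N m : ℕ} {Ω : Opens (Euc N)} {p : ℝ}

/-- The energy `J(u) = (1/p) ∫ A(x,u) |Du|^p - ∫ G(x,u)`. -/
noncomputable def energy (A G : Euc N → Euc m → ℝ) (u : SobolevZero Ω m p) : ℝ :=
  1 / p * (∫ x in (Ω : Set (Euc N)), A x (u.toFun x) * ‖u.jac x‖ ^ p)
    - ∫ x in (Ω : Set (Euc N)), G x (u.toFun x)

/-- The distribution
`-div (A(x,u) |Du|^{p-2} Du) + (1/p) ∇ₛA(x,u) |Du|^p - ∇ₛG(x,u)` acting on a test function. -/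
noncomputable def eulerDistribution (A G : Euc N → Euc m → ℝ) (u : SobolevZero Ω m p)
    (v : 𝓓(Ω, Euc m)) : ℝ :=
  (∫ x in (Ω : Set (Euc N)),
      A x (u.toFun x) * ‖u.jac x‖ ^ (p - 2) * inner ℝ (u.jac x) (jacobian v x))
    + 1 / p * (∫ x in (Ω : Set (Euc N)),
      inner ℝ (gradient (A x) (u.toFun x)) (v x) * ‖u.jac x‖ ^ p)
    - ∫ x in (Ω : Set (Euc N)), inner ℝ (gradient (G x) (u.toFun x)) (v x)

/-- `u` is a Concrete Palais-Smale sequence for the energy at level `c`. -/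
structure IsCPS (A G : Euc N → Euc m → ℝ) (c : ℝ) (u : ℕ → SobolevZero Ω m p) : Prop where
  /-- The energy of `u n` is well defined. Under the growth condition on `∇ₛG` used in the theorem
  this is automatic, except when `p = N` and the datum `a` in that condition is only in `L^1`. -/
  integrable : ∀ n, IntegrableOn (fun x => G x ((u n).toFun x)) (Ω : Set (Euc N))
  tendsto_energy : Tendsto (fun n => energy A G (u n)) atTop (𝓝 c)
  /-- The distributions belong to `W^{-1,p'}`. -/
  mem_dual : ∀ n, dualNorm Ω p (eulerDistribution A G (u n)) < ∞
  tendsto_dual : Tendsto (fun n => dualNorm Ω p (eulerDistribution A G (u n))) atTop (𝓝 0)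

end Functional

theorem norm_gradient_eq_norm_fderiv {E : Type*} [NormedAddCommGroup E] [InnerProductSpace ℝ E]
    [CompleteSpace E] (f : E → ℝ) (x : E) : ‖gradient f x‖ = ‖fderiv ℝ f x‖ := by
  rw [← toDual_gradient]
  exact ((InnerProductSpace.toDual ℝ E).norm_map _).symm

/-- A smooth cutoff function which decays so slowly that `‖s‖ * ‖∇ψ s‖` is uniformly small. -/
structure IsSlowCutoff {m : ℕ} (R δ M : ℝ) (ψ : Euc m → ℝ) : Prop where
  contDiff : ContDiff ℝ ((⊤ : ℕ∞) : WithTop ℕ∞) ψ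
  nonneg : ∀ s, 0 ≤ ψ s
  le_one : ∀ s, ψ s ≤ 1
  eq_one : ∀ s, ‖s‖ ≤ R → ψ s = 1
  norm_le : ∀ s, ψ s ≠ 0 → ‖s‖ ≤ M
  mul_norm_gradient_le : ∀ s, ‖s‖ * ‖gradient ψ s‖ ≤ δ

theorem IsSlowCutoff.gradient_eq_zero {m : ℕ} {R δ M : ℝ} {ψ : Euc m → ℝ}
    (h : IsSlowCutoff R δ M ψ) {s : Euc m} (hs : ‖s‖ ≤ R) : gradient ψ s = 0 := by
  have hmax : IsLocalMax ψ s := Eventually.of_forall fun y => by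
    rw [h.eq_one s hs]; exact h.le_one y
  rw [← norm_eq_zero, norm_gradient_eq_norm_fderiv, hmax.fderiv_eq_zero, norm_zero]

theorem exists_isSlowCutoff (m : ℕ) {R δ : ℝ} (hR : 0 < R) (hδ : 0 < δ) :
    ∃ (M : ℝ) (ψ : Euc m → ℝ), 0 < M ∧ IsSlowCutoff R δ M ψ := by
  let S : ContDiffBump (0 : ℝ) := ⟨1, 2, by norm_num, by norm_num⟩
  obtain ⟨L, hL⟩ : ∃ L, ∀ t, ‖deriv S t‖ ≤ L :=
    (S.hasCompactSupport.deriv).exists_bound_of_continuous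
      ((S.contDiff (n := 1)).continuous_deriv le_rfl)
  have hL0 : 0 ≤ L := (norm_nonneg _).trans (hL 0)
  set η : ℝ := min 1 (δ / (2 * L + 1)) with hη
  have hη0 : 0 < η := by positivity
  have hη1 : η ≤ 1 := min_le_left _ _
  have hη2 : 2 * L * η ≤ δ := by
    have h2 : η * (2 * L + 1) ≤ δ := by
      rw [← le_div_iff₀ (by positivity)]; exact min_le_right _ _
    linarith
  let τ : Euc m → ℝ := fun s => η * Real.log (1 + ‖s‖ ^ 2 / R ^ 2)
  have hpos : ∀ s : Euc m, 0 < 1 + ‖s‖ ^ 2 / R ^ 2 := fun s => by positivity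
  have hτ0 : ∀ s, 0 ≤ τ s := fun s => by
    have : 0 ≤ ‖s‖ ^ 2 / R ^ 2 := by positivity
    exact mul_nonneg hη0.le (Real.log_nonneg (by linarith))
  have hτs : ContDiff ℝ ((⊤ : ℕ∞) : WithTop ℕ∞) τ :=
    contDiff_const.mul (ContDiff.log (contDiff_const.add ((contDiff_norm_sq ℝ).div_const _))
      fun s => (hpos s).ne')
  refine ⟨R * Real.exp (2 / η), fun s => S (τ s), by positivity, ?_, fun s => S.nonneg,
    fun s => S.le_one, fun s hs => ?_, fun s hs => ?_, fun s => ?_⟩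
  · exact S.contDiff.comp hτs
  · apply S.one_of_mem_closedBall
    rw [mem_closedBall_zero_iff, Real.norm_of_nonneg (hτ0 s)]
    have h1 : ‖s‖ ^ 2 / R ^ 2 ≤ 1 := by
      rw [div_le_one (by positivity)]; exact pow_le_pow_left₀ (norm_nonneg s) hs 2
    have h2 : Real.log (1 + ‖s‖ ^ 2 / R ^ 2) ≤ 1 :=
      (Real.log_le_sub_one_of_pos (hpos s)).trans (by linarith)
    show τ s ≤ 1
    calc τ s ≤ η * 1 := mul_le_mul_of_nonneg_left h2 hη0.le
      _ ≤ 1 := by linarith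
  · have h1 : τ s < 2 := by
      have h2 : τ s ∈ Function.support S := hs
      rw [S.support_eq, mem_ball_zero_iff, Real.norm_of_nonneg (hτ0 s)] at h2
      exact h2
    have h2 : Real.log (1 + ‖s‖ ^ 2 / R ^ 2) < 2 / η := by
      rw [lt_div_iff₀ hη0, mul_comm]; exact h1
    have h3 : 1 + ‖s‖ ^ 2 / R ^ 2 < Real.exp (2 / η) := by
      rwa [← Real.log_lt_iff_lt_exp (hpos s)]
    have h4 : 1 ≤ Real.exp (2 / η) := Real.one_le_exp (by positivity)
    have h5 : ‖s‖ ^ 2 ≤ Real.exp (2 / η) * R ^ 2 := by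
      rw [← div_le_iff₀ (by positivity)]; linarith
    apply le_of_sq_le_sq ?_ (by positivity)
    calc ‖s‖ ^ 2 ≤ Real.exp (2 / η) * R ^ 2 := h5
      _ ≤ Real.exp (2 / η) ^ 2 * R ^ 2 := by gcongr; nlinarith
      _ = _ := by ring
  · have hd : HasFDerivAt τ ((η * (2 / (R ^ 2 + ‖s‖ ^ 2))) • innerSL ℝ s) s := by
      have h1 : HasFDerivAt (fun s : Euc m => ‖s‖ ^ 2) (2 • innerSL ℝ s) s :=
        (hasStrictFDerivAt_norm_sq s).hasFDerivAt
      have h2 := (((h1.mul_const (R ^ 2)⁻¹).const_add 1).log (by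
        have := (hpos s).ne'
        simpa [div_eq_mul_inv] using this)).const_mul η
      refine (h2.congr_fderiv ?_).congr_of_eventuallyEq
        (Eventually.of_forall fun y => by simp [τ, div_eq_mul_inv])
      ext y
      simp
      field_simp
    have hS : HasDerivAt S (deriv S (τ s)) (τ s) :=
      ((S.contDiff (n := 1)).differentiable one_ne_zero _).hasDerivAt
    rw [norm_gradient_eq_norm_fderiv]
    have h3 := (hS.comp_hasFDerivAt s hd).fderiv
    rw [show (fun s => S (τ s)) = S ∘ τ from rfl, h3, norm_smul, norm_smul, innerSL_apply_norm,
      Real.norm_of_nonneg (show 0 ≤ η * (2 / (R ^ 2 + ‖s‖ ^ 2)) by positivity)]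
    have h4 : ‖s‖ * (2 / (R ^ 2 + ‖s‖ ^ 2) * ‖s‖) ≤ 2 := by
      have : ‖s‖ * (2 / (R ^ 2 + ‖s‖ ^ 2) * ‖s‖) = 2 * ‖s‖ ^ 2 / (R ^ 2 + ‖s‖ ^ 2) := by ring
      rw [this, div_le_iff₀ (by positivity)]
      nlinarith [sq_nonneg R]
    calc ‖s‖ * (‖deriv S (τ s)‖ * (η * (2 / (R ^ 2 + ‖s‖ ^ 2)) * ‖s‖))
        = ‖deriv S (τ s)‖ * η * (‖s‖ * (2 / (R ^ 2 + ‖s‖ ^ 2) * ‖s‖)) := by ring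
      _ ≤ L * η * 2 := by gcongr; exact hL _
      _ ≤ δ := by linarith

theorem norm_sum_smul_row_le {N m : ℕ} (y : Euc m) (M : Mat m N) :
    ‖∑ k, y k • M k‖ ≤ ‖y‖ * ‖M‖ := by
  calc ‖∑ k, y k • M k‖ ≤ ∑ k, ‖y k‖ * ‖M k‖ :=
        (norm_sum_le _ _).trans_eq (by simp only [norm_smul])
    _ ≤ √(∑ k, ‖y k‖ ^ 2) * √(∑ k, ‖M k‖ ^ 2) := Real.sum_mul_le_sqrt_mul_sqrt _ _ _
    _ = ‖y‖ * ‖M‖ := by rw [EuclideanSpace.norm_eq, PiLp.norm_eq_of_L2]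

/-- The Jacobian matrix of `x ↦ ψ (w x) • w x` at a point where `w` has the value `s` and the
Jacobian matrix `M`. -/
noncomputable def cutoffJac {N m : ℕ} (ψ : Euc m → ℝ) (s : Euc m) (M : Mat m N) : Mat m N :=
  ψ s • M + WithLp.toLp 2 fun i => s i • ∑ k, gradient ψ s k • M k

theorem norm_cutoffJac_sub_le {N m : ℕ} (ψ : Euc m → ℝ) (s : Euc m) (M : Mat m N) :
    ‖cutoffJac ψ s M - ψ s • M‖ ≤ ‖s‖ * ‖gradient ψ s‖ * ‖M‖ := by
  set y := ∑ k, gradient ψ s k • M k with hy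
  have h1 : ‖cutoffJac ψ s M - ψ s • M‖ = ‖s‖ * ‖y‖ := by
    rw [cutoffJac, add_sub_cancel_left, PiLp.norm_eq_of_L2, EuclideanSpace.norm_eq s,
      ← Real.sqrt_sq (norm_nonneg y), ← Real.sqrt_mul (by positivity), Finset.sum_mul]
    simp only [norm_smul, mul_pow]
    rfl
  rw [h1, mul_assoc]
  gcongr
  exact norm_sum_smul_row_le _ _

theorem continuous_gradient {E : Type*} [NormedAddCommGroup E] [InnerProductSpace ℝ E]
    [CompleteSpace E] {f : E → ℝ} (hf : ContDiff ℝ 1 f) : Continuous (gradient f) :=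
  (InnerProductSpace.toDual ℝ E).symm.continuous.comp (hf.continuous_fderiv one_ne_zero)

theorem continuous_cutoffJac {N m : ℕ} {ψ : Euc m → ℝ} (hψ : ContDiff ℝ 1 ψ) :
    Continuous fun z : Euc m × Mat m N => cutoffJac ψ z.1 z.2 := by
  have h1 := hψ.continuous
  have h2 := continuous_gradient hψ
  unfold cutoffJac
  refine ((h1.comp continuous_fst).smul continuous_snd).add
    ((PiLp.continuous_toLp 2 _).comp (continuous_pi fun i => ?_))
  refine Continuous.smul ((PiLp.continuous_apply 2 _ i).comp continuous_fst)
    (continuous_finsetSum _ fun k _ => ?_)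
  exact Continuous.smul ((PiLp.continuous_apply 2 _ k).comp (h2.comp continuous_fst))
    ((PiLp.continuous_apply 2 _ k).comp continuous_snd)

theorem jacobian_apply {N m : ℕ} (v : Euc N → Euc m) (x : Euc N) (i : Fin m) :
    jacobian v x i = gradient (fun y => v y i) x := rfl

theorem HasFDerivAt.coord {N m : ℕ} {v : Euc N → Euc m} {x : Euc N} {v' : Euc N →L[ℝ] Euc m}
    (hv : HasFDerivAt v v' x) (i : Fin m) :
    HasFDerivAt (fun y => v y i) ((EuclideanSpace.proj i).comp v') x :=
  (EuclideanSpace.proj (𝕜 := ℝ) i).hasFDerivAt.comp x hv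

theorem differentiableAt_coord {N m : ℕ} {v : Euc N → Euc m} {x : Euc N}
    (hv : DifferentiableAt ℝ v x) (i : Fin m) : DifferentiableAt ℝ (fun y => v y i) x :=
  (differentiableAt_euclidean.1 hv) i

theorem jacobian_cutoff {N m : ℕ} {ψ : Euc m → ℝ} {w : Euc N → Euc m} {x : Euc N}
    (hψ : DifferentiableAt ℝ ψ (w x)) (hw : DifferentiableAt ℝ w x) :
    jacobian (fun y => ψ (w y) • w y) x = cutoffJac ψ (w x) (jacobian w x) := by
  have hwf := hw.hasFDerivAt
  have hψw : HasFDerivAt (fun y => ψ (w y)) ((fderiv ℝ ψ (w x)).comp (fderiv ℝ w x)) x :=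
    hψ.hasFDerivAt.comp x hwf
  have hcoord : ∀ i y, inner ℝ (gradient (fun y => w y i) x) y = fderiv ℝ w x y i := fun i y => by
    have h := hwf.coord i
    rw [inner_gradient_left, h.fderiv]; rfl
  refine PiLp.ext fun i => ?_
  rw [jacobian_apply]
  refine ext_inner_right ℝ fun y => ?_
  have hi : HasFDerivAt (fun y => (ψ (w y) • w y) i) _ x :=
    hψw.mul (hwf.coord i)
  rw [inner_gradient_left, hi.fderiv]
  simp only [cutoffJac, PiLp.add_apply, PiLp.smul_apply, inner_add_left, inner_smul_left,
    sum_inner, jacobian_apply, hcoord]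
  have h2 : fderiv ℝ ψ (w x) (fderiv ℝ w x y)
      = ∑ k, gradient ψ (w x) k * fderiv ℝ w x y k := by
    rw [← inner_gradient_left, PiLp.inner_apply]
    simp [mul_comm]
  simp [h2]

theorem norm_fderiv_le_norm_jacobian {N m : ℕ} {w : Euc N → Euc m} {x : Euc N}
    (hw : DifferentiableAt ℝ w x) : ‖fderiv ℝ w x‖ ≤ ‖jacobian w x‖ := by
  refine ContinuousLinearMap.opNorm_le_bound _ (norm_nonneg _) fun y => ?_
  have hcoord : ∀ i, fderiv ℝ w x y i = inner ℝ (jacobian w x i) y := fun i => by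
    have h := hw.hasFDerivAt.coord i
    rw [jacobian_apply, inner_gradient_left, h.fderiv]; rfl
  rw [EuclideanSpace.norm_eq, PiLp.norm_eq_of_L2, ← Real.sqrt_sq (norm_nonneg y),
    ← Real.sqrt_mul (by positivity), Finset.sum_mul]
  refine Real.sqrt_le_sqrt (Finset.sum_le_sum fun i _ => ?_)
  rw [hcoord, ← mul_pow]
  gcongr
  exact norm_inner_le_norm _ _

theorem jacobian_const_smul {N m : ℕ} (c : ℝ) {w : Euc N → Euc m} {x : Euc N}
    (hw : DifferentiableAt ℝ w x) : jacobian (fun y => c • w y) x = c • jacobian w x := by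
  refine PiLp.ext fun i => ext_inner_right ℝ fun y => ?_
  have h := ((differentiableAt_coord hw i).hasFDerivAt.const_mul c)
  rw [jacobian_apply, inner_gradient_left, PiLp.smul_apply, inner_smul_left, jacobian_apply,
    inner_gradient_left]
  simp only [PiLp.smul_apply, smul_eq_mul, h.fderiv]
  rfl

theorem continuous_jacobian {N m : ℕ} {w : Euc N → Euc m} (hw : ContDiff ℝ 1 w) :
    Continuous (jacobian w) :=
  (PiLp.continuous_toLp 2 _).comp (continuous_pi fun i =>
    continuous_gradient (contDiff_euclidean.1 hw i))

/-- Measurability of the superposition of a Carathéodory map with a measurable function. -/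
theorem aestronglyMeasurable_comp_of_ae_continuous {α E F : Type*} [MeasurableSpace α]
    {μ : Measure α} [NormedAddCommGroup E] [MeasurableSpace E] [BorelSpace E]
    [SecondCountableTopology E] [NormedAddCommGroup F]
    {f : α → E → F} (hf : ∀ s, AEStronglyMeasurable (fun x => f x s) μ)
    (hc : ∀ᵐ x ∂μ, Continuous (f x)) {u : α → E} (hu : AEStronglyMeasurable u μ) :
    AEStronglyMeasurable (fun x => f x (u x)) μ := by
  obtain ⟨v, hv, huv⟩ := hu
  have key : AEStronglyMeasurable (fun x => f x (v x)) μ := by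
    refine aestronglyMeasurable_of_tendsto_ae (u := atTop)
      (f := fun n x => f x (hv.approx n x)) (fun n => ?_) ?_
    · set φ := hv.approx n
      have h : (fun x => f x (φ x)) = fun x => ∑ s ∈ φ.range, (φ ⁻¹' {s}).indicator
          (fun x => f x s) x := by
        funext x
        rw [Finset.sum_eq_single (φ x)]
        · simp
        · intro s _ hs
          rw [Set.indicator_of_notMem]
          simpa using hs.symm
        · intro h; exact absurd (φ.mem_range_self x) h
      rw [h]
      exact Finset.aestronglyMeasurable_fun_sum _ fun s _ =>
        (hf s).indicator (φ.measurableSet_fiber s)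
    · filter_upwards [hc] with x hx
      exact (hx.tendsto (v x)).comp (hv.tendsto_approx x)
  refine key.congr ?_
  filter_upwards [huv] with x hx
  rw [hx]

theorem IsC1Caratheodory.aestronglyMeasurable_comp {N m : ℕ} {Ω : Opens (Euc N)}
    {F : Euc N → Euc m → ℝ} (hF : IsC1Caratheodory Ω F) {u : Euc N → Euc m}
    (hu : AEStronglyMeasurable u (volume.restrict Ω)) :
    AEStronglyMeasurable (fun x => F x (u x)) (volume.restrict Ω) :=
  aestronglyMeasurable_comp_of_ae_continuous (fun s => (hF.1 s).aestronglyMeasurable)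
    (hF.2.mono fun _ hx => hx.continuous) hu

theorem IsC1Caratheodory.aestronglyMeasurable_gradient {N m : ℕ} {Ω : Opens (Euc N)}
    {F : Euc N → Euc m → ℝ} (hF : IsC1Caratheodory Ω F) (s : Euc m) :
    AEStronglyMeasurable (fun x => gradient (F x) s) (volume.restrict Ω) := by
  have h1 : ∀ i : Fin m, AEStronglyMeasurable (fun x => gradient (F x) s i)
      (volume.restrict Ω) := fun i => by
    let e : Euc m := EuclideanSpace.single i 1
    let t : ℕ → ℝ := fun n => 1 / ((n : ℝ) + 1)
    have ht : Tendsto t atTop (𝓝[≠] 0) := tendsto_nhdsWithin_iff.2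
      ⟨tendsto_one_div_add_atTop_nhds_zero_nat, Eventually.of_forall fun n =>
        (show t n ≠ 0 by positivity)⟩
    refine aestronglyMeasurable_of_tendsto_ae (u := atTop)
      (f := fun n x => (t n)⁻¹ • (F x (s + t n • e) - F x s)) (fun n => ?_) ?_
    · exact ((hF.1 (s + t n • e)).sub (hF.1 s)).aestronglyMeasurable.const_smul (t n)⁻¹
    · filter_upwards [hF.2] with x hx
      have hd := ((hx.differentiable one_ne_zero) s).hasFDerivAt.hasLineDerivAt e
      have h := hd.tendsto_slope_zero.comp ht
      have he : fderiv ℝ (F x) s e = gradient (F x) s i := by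
        rw [← inner_gradient_left, real_inner_comm]
        exact (EuclideanSpace.inner_single_left i (1 : ℝ) _).trans (by simp)
      rw [he] at h
      exact h
  have h2 : (fun x => gradient (F x) s)
      = fun x => WithLp.toLp 2 (fun i => gradient (F x) s i) := rfl
  rw [h2]
  exact (PiLp.continuous_toLp 2 _).comp_aestronglyMeasurable
    (aemeasurable_pi_lambda _ fun i => (h1 i).aemeasurable).aestronglyMeasurable

theorem IsC1Caratheodory.aestronglyMeasurable_gradient_comp {N m : ℕ} {Ω : Opens (Euc N)}
    {F : Euc N → Euc m → ℝ} (hF : IsC1Caratheodory Ω F) {u : Euc N → Euc m}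
    (hu : AEStronglyMeasurable u (volume.restrict Ω)) :
    AEStronglyMeasurable (fun x => gradient (F x) (u x)) (volume.restrict Ω) :=
  aestronglyMeasurable_comp_of_ae_continuous hF.aestronglyMeasurable_gradient
    (hF.2.mono fun _ hx => continuous_gradient hx) hu

theorem TestFunction.contDiff_one {N m : ℕ} {Ω : Opens (Euc N)} (φ : 𝓓(Ω, Euc m)) :
    ContDiff ℝ 1 φ := φ.contDiff.of_le (by exact_mod_cast le_top)

theorem SobolevZero.exists_tendsto {N m : ℕ} {Ω : Opens (Euc N)} {p : ℝ} (hp : 1 < p)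
    (u : SobolevZero Ω m p) : ∃ w : ℕ → 𝓓(Ω, Euc m),
      (∀ n, MemLp (jacobian (w n)) (ENNReal.ofReal p) (volume.restrict Ω)) ∧
      Tendsto (fun n => eLpNorm (jacobian (w n) - u.jac) (ENNReal.ofReal p)
        (volume.restrict Ω)) atTop (𝓝 0) ∧
      (∀ᵐ x ∂(volume.restrict (Ω : Set (Euc N))),
        Tendsto (fun n => w n x) atTop (𝓝 (u.toFun x))) ∧
      ∀ᵐ x ∂(volume.restrict (Ω : Set (Euc N))),
        Tendsto (fun n => jacobian (w n) x) atTop (𝓝 (u.jac x)) := by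
  have hp0 : ENNReal.ofReal p ≠ 0 := by simp; linarith
  have hε : ∀ n : ℕ, 0 < ((n : ℝ≥0∞) + 1)⁻¹ := fun n =>
    ENNReal.inv_pos.2 (by finiteness)
  choose φ h1 h2 using fun n : ℕ => u.approx _ (hε n)
  have hlim : Tendsto (fun n : ℕ => ((n : ℝ≥0∞) + 1)⁻¹) atTop (𝓝 0) := by
    have := (tendsto_add_atTop_iff_nat 1).2 ENNReal.tendsto_inv_nat_nhds_zero
    simpa using this
  have hjm : ∀ n, AEStronglyMeasurable (jacobian (φ n)) (volume.restrict (Ω : Set (Euc N))) :=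
    fun n => (continuous_jacobian (φ n).contDiff_one).aestronglyMeasurable
  have hmem : ∀ n, MemLp (jacobian (φ n)) (ENNReal.ofReal p) (volume.restrict Ω) := fun n => by
    have hd : MemLp (fun x => u.jac x - jacobian (φ n) x) (ENNReal.ofReal p)
        (volume.restrict Ω) := ⟨u.memLp_jac.1.sub (hjm n), (h2 n).trans_le le_top⟩
    refine (u.memLp_jac.sub hd).congr_norm (hjm n) (Eventually.of_forall fun x => by simp)
  have t1 : Tendsto (fun n => eLpNorm (⇑(φ n) - u.toFun) (ENNReal.ofReal p)
      (volume.restrict Ω)) atTop (𝓝 0) := by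
    refine tendsto_of_tendsto_of_tendsto_of_le_of_le tendsto_const_nhds hlim
      (fun _ => zero_le) fun n => ?_
    dsimp only
    rw [eLpNorm_sub_comm]
    exact (h1 n).le
  have t2 : Tendsto (fun n => eLpNorm (jacobian (φ n) - u.jac) (ENNReal.ofReal p)
      (volume.restrict Ω)) atTop (𝓝 0) := by
    refine tendsto_of_tendsto_of_tendsto_of_le_of_le tendsto_const_nhds hlim
      (fun _ => zero_le) fun n => ?_
    dsimp only
    rw [eLpNorm_sub_comm]
    exact (h2 n).le
  obtain ⟨ns, hns, hae1⟩ := (tendstoInMeasure_of_tendsto_eLpNorm hp0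
    (fun n => (φ n).continuous.aestronglyMeasurable) u.memLp.1 t1).exists_seq_tendsto_ae
  obtain ⟨ms, hms, hae2⟩ := (tendstoInMeasure_of_tendsto_eLpNorm hp0
    (fun n => hjm (ns n)) u.memLp_jac.1 (t2.comp hns.tendsto_atTop)).exists_seq_tendsto_ae
  refine ⟨fun n => φ (ns (ms n)), fun n => hmem _,
    t2.comp (hns.tendsto_atTop.comp hms.tendsto_atTop), ?_, hae2⟩
  filter_upwards [hae1] with x hx using hx.comp hms.tendsto_atTop

theorem eLpNorm_restrict_eq_of_support_subset' {E F : Type*} [MeasurableSpace E]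
    {μ : Measure E} [NormedAddCommGroup F] {f : E → F} {s : Set E}
    (h : Function.support f ⊆ s) (p : ℝ≥0∞) : eLpNorm f p (μ.restrict s) = eLpNorm f p μ :=
  eLpNorm_restrict_eq_of_support_subset h

theorem eLpNorm_le_eLpNorm_jacobian {N m : ℕ} {Ω : Set (Euc N)} (hΩ : Bornology.IsBounded Ω)
    {t q : NNReal} {w : Euc N → Euc m} (hw : ContDiff ℝ 1 w) (hs : tsupport w ⊆ Ω)
    (ht : 1 ≤ t) (htN : t < N) (htq : (t : ℝ)⁻¹ - (N : ℝ)⁻¹ ≤ (q : ℝ)⁻¹) :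
    eLpNorm w q (volume.restrict Ω) ≤
      eLpNormLESNormFDerivOfLeConst (Euc m) (volume : Measure (Euc N)) Ω t q
        * eLpNorm (jacobian w) t (volume.restrict Ω) := by
  have h1 : t < Module.finrank ℝ (Euc N) := by rwa [finrank_euclideanSpace_fin]
  have h2 : eLpNorm w q volume ≤
      eLpNormLESNormFDerivOfLeConst (Euc m) (volume : Measure (Euc N)) Ω t q
        * eLpNorm (fderiv ℝ w) t volume :=
    eLpNorm_le_eLpNorm_fderiv_of_le volume hw ((subset_tsupport _).trans hs) ht h1
      (by rwa [finrank_euclideanSpace_fin]) hΩ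
  refine (eLpNorm_mono_measure _ Measure.restrict_le_self).trans (h2.trans ?_)
  rw [← eLpNorm_restrict_eq_of_support_subset' ((support_fderiv_subset ℝ).trans hs)]
  gcongr
  exact eLpNorm_mono fun x => norm_fderiv_le_norm_jacobian (hw.differentiable one_ne_zero x)

/-- The Sobolev embedding of `W_0^{1,p}` in `L^q` below the critical exponent. -/
theorem SobolevZero.memLp_of_lt_critical {N m : ℕ} (hN : 1 < N) {Ω : Opens (Euc N)} {p : ℝ}
    (hp : 1 < p) (hΩ : Bornology.IsBounded (Ω : Set (Euc N))) {q : ℝ} (hq1 : 1 < q)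
    (hq : p < N → q < N * p / (N - p)) (u : SobolevZero Ω m p) :
    MemLp u.toFun (ENNReal.ofReal q) (volume.restrict Ω) := by
  have hN' : (1 : ℝ) < N := by exact_mod_cast hN
  have hN0 : (0 : ℝ) < N := by linarith
  have hq0 : 0 < q := by linarith
  have : IsFiniteMeasure (volume.restrict (Ω : Set (Euc N))) :=
    ⟨by simpa using hΩ.measure_lt_top⟩
  set t : ℝ := max 1 (N * q / (N + q)) with ht
  have ht1 : 1 ≤ t := le_max_left _ _
  have htN : t < N := max_lt hN' (by
    rw [div_lt_iff₀ (by positivity)]; nlinarith)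
  have htp : t ≤ p := by
    refine max_le hp.le ?_
    rw [div_le_iff₀ (by positivity)]
    by_cases h : p < N
    · have h1 := hq h
      rw [lt_div_iff₀ (by linarith)] at h1
      nlinarith
    · push Not at h
      nlinarith
  have htq : t⁻¹ - (N : ℝ)⁻¹ ≤ q⁻¹ := by
    have h1 : t⁻¹ ≤ (N * q / (N + q))⁻¹ := inv_anti₀ (by positivity) (le_max_right _ _)
    have h2 : (N * q / (N + q))⁻¹ = q⁻¹ + (N : ℝ)⁻¹ := by field_simp
    linarith
  obtain ⟨w, hw1, hw2, hw3, -⟩ := u.exists_tendsto hp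
  set C := eLpNormLESNormFDerivOfLeConst (Euc m) (volume : Measure (Euc N)) Ω t.toNNReal
    q.toNNReal
  set V := (volume.restrict (Ω : Set (Euc N))) Set.univ
  have hbound : ∀ n, eLpNorm (w n) (ENNReal.ofReal q) (volume.restrict Ω) ≤
      C * (eLpNorm (jacobian (w n)) (ENNReal.ofReal p) (volume.restrict Ω)
        * V ^ (1 / (ENNReal.ofReal t).toReal - 1 / (ENNReal.ofReal p).toReal)) := fun n => by
    refine (eLpNorm_le_eLpNorm_jacobian (t := t.toNNReal) (q := q.toNNReal) hΩ
      (w n).contDiff_one (w n).tsupport_subset ?_ ?_ ?_).trans ?_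
    · simpa using Real.toNNReal_le_toNNReal ht1
    · rw [← NNReal.coe_lt_coe, Real.coe_toNNReal _ (by linarith)]
      exact_mod_cast htN
    · rw [Real.coe_toNNReal _ (by linarith), Real.coe_toNNReal _ hq0.le]
      exact htq
    · gcongr
      exact eLpNorm_le_eLpNorm_mul_rpow_measure_univ (ENNReal.ofReal_le_ofReal htp)
        (hw1 n).1
  have hV : V ^ (1 / (ENNReal.ofReal t).toReal - 1 / (ENNReal.ofReal p).toReal) < ∞ := by
    refine ENNReal.rpow_lt_top_of_nonneg ?_ (measure_ne_top _ _)
    rw [ENNReal.toReal_ofReal (by linarith), ENNReal.toReal_ofReal (by linarith), sub_nonneg]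
    exact one_div_le_one_div_of_le (by linarith) htp
  set B := eLpNorm u.jac (ENNReal.ofReal p) (volume.restrict Ω)
  have hev : ∀ᶠ n in atTop, eLpNorm (w n) (ENNReal.ofReal q) (volume.restrict Ω) ≤
      C * ((1 + B) * V ^ (1 / (ENNReal.ofReal t).toReal - 1 / (ENNReal.ofReal p).toReal)) := by
    filter_upwards [hw2.eventually (gt_mem_nhds zero_lt_one)] with n hn
    refine (hbound n).trans ?_
    gcongr
    have := eLpNorm_add_le (p := ENNReal.ofReal p) ((hw1 n).1.sub u.memLp_jac.1)
      u.memLp_jac.1 (by simpa using ENNReal.ofReal_le_ofReal hp.le)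
    rw [sub_add_cancel] at this
    exact this.trans (by gcongr)
  refine ⟨u.memLp.1, ?_⟩
  refine ((Lp.eLpNorm_lim_le_liminf_eLpNorm
    (fun n => (w n).continuous.aestronglyMeasurable) _ hw3).trans
      (liminf_le_of_frequently_le' hev.frequently)).trans_lt ?_
  have hB : B < ∞ := u.memLp_jac.2
  exact ENNReal.mul_lt_top ENNReal.coe_lt_top
    (ENNReal.mul_lt_top (ENNReal.add_lt_top.2 ⟨ENNReal.one_lt_top, hB⟩) hV)

/-- Vitali convergence for a sequence dominated by a sequence converging in `L^p`. -/
theorem tendsto_eLpNorm_of_norm_le_mul {α E F : Type*} [MeasurableSpace α] {μ : Measure α}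
    [IsFiniteMeasure μ] [NormedAddCommGroup E] [NormedAddCommGroup F] {p : ℝ≥0∞}
    (hp : 1 ≤ p) (hp' : p ≠ ∞) {f : ℕ → α → E} {g : α → E} {h : ℕ → α → F} {k : α → F} {c : ℝ}
    (hf : ∀ n, AEStronglyMeasurable (f n) μ) (hg : MemLp g p μ) (hh : ∀ n, MemLp (h n) p μ)
    (hk : MemLp k p μ) (hfh : ∀ n x, ‖f n x‖ ≤ c * ‖h n x‖)
    (hhk : Tendsto (fun n => eLpNorm (h n - k) p μ) atTop (𝓝 0))
    (hfg : ∀ᵐ x ∂μ, Tendsto (fun n => f n x) atTop (𝓝 (g x))) :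
    Tendsto (fun n => eLpNorm (f n - g) p μ) atTop (𝓝 0) := by
  refine tendsto_Lp_finite_of_tendsto_ae hp hp' hf hg ?_ hfg
  intro ε hε
  have hc : 0 < max c 1 := lt_max_of_lt_right one_pos
  obtain ⟨δ, hδ, H⟩ := unifIntegrable_of_tendsto_Lp hp hp' hh hk hhk
    (ε := ε / max c 1) (by positivity)
  refine ⟨δ, hδ, fun i s hs hμs => ?_⟩
  calc eLpNorm (s.indicator (f i)) p μ
      ≤ ENNReal.ofReal (max c 1) * eLpNorm (s.indicator (h i)) p μ := by
        refine eLpNorm_le_mul_eLpNorm_of_ae_le_mul (Eventually.of_forall fun x => ?_) _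
        by_cases hx : x ∈ s
        · simp only [Set.indicator_of_mem hx]
          refine (hfh i x).trans ?_
          gcongr
          exact le_max_left _ _
        · simp [Set.indicator_of_notMem hx]
    _ ≤ ENNReal.ofReal (max c 1) * ENNReal.ofReal (ε / max c 1) := by
        gcongr
        exact H i s hs hμs
    _ = ENNReal.ofReal ε := by
        rw [← ENNReal.ofReal_mul hc.le, mul_div_cancel₀ _ hc.ne']

/-- The Euler form of the energy at `u`, as a function of a test map `v` and its Jacobian `Dv`. -/
noncomputable def eulerForm {N m : ℕ} {Ω : Opens (Euc N)} {p : ℝ} (A G : Euc N → Euc m → ℝ)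
    (u : SobolevZero Ω m p) (v : Euc N → Euc m) (Dv : Euc N → Mat m N) : ℝ :=
  (∫ x in (Ω : Set (Euc N)),
      A x (u.toFun x) * ‖u.jac x‖ ^ (p - 2) * inner ℝ (u.jac x) (Dv x))
    + 1 / p * (∫ x in (Ω : Set (Euc N)),
      inner ℝ (gradient (A x) (u.toFun x)) (v x) * ‖u.jac x‖ ^ p)
    - ∫ x in (Ω : Set (Euc N)), inner ℝ (gradient (G x) (u.toFun x)) (v x)

theorem eulerForm_const_smul {N m : ℕ} {Ω : Opens (Euc N)} {p : ℝ} (A G : Euc N → Euc m → ℝ)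
    (u : SobolevZero Ω m p) (v : Euc N → Euc m) (Dv : Euc N → Mat m N) (t : ℝ) :
    eulerForm A G u (fun x => t • v x) (fun x => t • Dv x) = t * eulerForm A G u v Dv := by
  simp only [eulerForm, inner_smul_right, mul_sub, mul_add, ← integral_const_mul]
  congr 1
  congr 1 <;> (congr 1; funext x; ring)

theorem abs_eulerDistribution_le {N m : ℕ} {Ω : Opens (Euc N)} {p : ℝ}
    (A G : Euc N → Euc m → ℝ) (u : SobolevZero Ω m p)
    (hfin : dualNorm Ω p (eulerDistribution A G u) < ∞) {B : ℝ} (hB : 0 < B)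
    (v : 𝓓(Ω, Euc m))
    (hv : eLpNorm (jacobian v) (ENNReal.ofReal p) (volume.restrict Ω) ≤ ENNReal.ofReal B) :
    |eulerDistribution A G u v| ≤ (dualNorm Ω p (eulerDistribution A G u)).toReal * B := by
  have hj : jacobian (B⁻¹ • v : 𝓓(Ω, Euc m)) = B⁻¹ • jacobian v := by
    funext x
    exact jacobian_const_smul B⁻¹ (v.contDiff_one.differentiable one_ne_zero x)
  have h1 : eLpNorm (jacobian (B⁻¹ • v : 𝓓(Ω, Euc m))) (ENNReal.ofReal p)
      (volume.restrict Ω) ≤ 1 := by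
    rw [hj, eLpNorm_const_smul]
    calc _ ≤ ‖B⁻¹‖ₑ * ENNReal.ofReal B := by gcongr
      _ = 1 := by
        rw [Real.enorm_of_nonneg (by positivity), ← ENNReal.ofReal_mul (by positivity),
          inv_mul_cancel₀ hB.ne', ENNReal.ofReal_one]
  have h2 : ENNReal.ofReal |eulerDistribution A G u (B⁻¹ • v)|
      ≤ dualNorm Ω p (eulerDistribution A G u) :=
    le_iSup₂ (f := fun (v : 𝓓(Ω, Euc m))
      (_ : eLpNorm (jacobian v) (ENNReal.ofReal p) (volume.restrict Ω) ≤ 1) =>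
        ENNReal.ofReal |eulerDistribution A G u v|) (B⁻¹ • v) h1
  have h3 : eulerDistribution A G u (B⁻¹ • v) = B⁻¹ * eulerDistribution A G u v := by
    have := eulerForm_const_smul A G u v (jacobian v) B⁻¹
    have h4 : eulerDistribution A G u (B⁻¹ • v)
        = eulerForm A G u (fun x => B⁻¹ • v x) (jacobian (B⁻¹ • v : 𝓓(Ω, Euc m))) := rfl
    rw [h4, hj]
    exact this
  rw [h3, ENNReal.ofReal_le_iff_le_toReal hfin.ne, abs_mul, abs_of_pos (inv_pos.2 hB),
    inv_mul_le_iff₀ hB, mul_comm] at h2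
  exact h2

theorem tendsto_eulerForm {N m : ℕ} {Ω : Opens (Euc N)} {p : ℝ} (hp : 1 < p)
    {A G : Euc N → Euc m → ℝ} (hA : IsC1Caratheodory Ω A) (hG : IsC1Caratheodory Ω G) {C₀ : ℝ}
    (ha1 : ∀ᵐ x ∂(volume.restrict (Ω : Set (Euc N))), ∀ s : Euc m,
      |A x s| ≤ C₀ ∧ ‖gradient (A x) s‖ ≤ C₀)
    (u : SobolevZero Ω m p)
    (hg : IntegrableOn (fun x => gradient (G x) (u.toFun x)) (Ω : Set (Euc N)))
    {v : ℕ → Euc N → Euc m} {V : Euc N → Euc m} {Dv : ℕ → Euc N → Mat m N}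
    {DV : Euc N → Mat m N} {M : ℝ}
    (hv : ∀ n, AEStronglyMeasurable (v n) (volume.restrict Ω)) (hvM : ∀ n x, ‖v n x‖ ≤ M)
    (hvV : ∀ᵐ x ∂(volume.restrict (Ω : Set (Euc N))),
      Tendsto (fun n => v n x) atTop (𝓝 (V x)))
    (hDv : ∀ n, MemLp (Dv n) (ENNReal.ofReal p) (volume.restrict Ω))
    (hDV : MemLp DV (ENNReal.ofReal p) (volume.restrict Ω))
    (hlim : Tendsto (fun n => eLpNorm (Dv n - DV) (ENNReal.ofReal p) (volume.restrict Ω))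
      atTop (𝓝 0)) :
    Tendsto (fun n => eulerForm A G u (v n) (Dv n)) atTop (𝓝 (eulerForm A G u V DV)) := by
  have hp0 : 0 < p := by linarith
  have hjp : Integrable (fun x => ‖u.jac x‖ ^ p) (volume.restrict (Ω : Set (Euc N))) := by
    have := u.memLp_jac.integrable_norm_rpow (by simpa using hp0) (by simp)
    simpa only [ENNReal.toReal_ofReal hp0.le] using this
  have hgA := hA.aestronglyMeasurable_gradient_comp u.memLp.1
  have hgG := hG.aestronglyMeasurable_gradient_comp u.memLp.1
  refine (Tendsto.add ?_ (Tendsto.const_mul _ ?_)).sub ?_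
  · set F : Euc N → Mat m N := fun x => (A x (u.toFun x) * ‖u.jac x‖ ^ (p - 2)) • u.jac x
    have hFm : AEStronglyMeasurable F (volume.restrict (Ω : Set (Euc N))) :=
      ((hA.aestronglyMeasurable_comp u.memLp.1).mul
        (u.memLp_jac.1.norm.aemeasurable.pow_const _).aestronglyMeasurable).smul u.memLp_jac.1
    have hF : MemLp F (ENNReal.ofReal (p / (p - 1))) (volume.restrict Ω) := by
      have h1 := u.memLp_jac.norm_rpow_div (ENNReal.ofReal (p - 1))
      rw [← ENNReal.ofReal_div_of_pos (by linarith), ENNReal.toReal_ofReal (by linarith)] at h1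
      refine h1.of_le_mul (c := C₀) hFm ?_
      filter_upwards [ha1] with x hx
      simp only [F, norm_smul, norm_mul, Real.norm_eq_abs,
        abs_of_nonneg (Real.rpow_nonneg (norm_nonneg (u.jac x)) _)]
      have h2 : ‖u.jac x‖ ^ (p - 2) * ‖u.jac x‖ ≤ ‖u.jac x‖ ^ (p - 1) := by
        rcases (norm_nonneg (u.jac x)).eq_or_lt with h0 | h0
        · rw [← h0, mul_zero]; positivity
        · rw [← Real.rpow_add_one h0.ne']
          exact le_of_eq (by congr 1; ring)
      rw [mul_assoc]
      exact mul_le_mul (hx _).1 h2 (by positivity) ((abs_nonneg _).trans (hx 0).1)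
    have : ENNReal.HolderConjugate (ENNReal.ofReal (p / (p - 1))) (ENNReal.ofReal p) :=
      (Real.HolderConjugate.conjExponent hp).symm.ennrealOfReal
    have hint : ∀ n, Integrable (fun x => inner ℝ (F x) (Dv n x))
        (volume.restrict (Ω : Set (Euc N))) := fun n => by
      rw [← memLp_one_iff_integrable]
      exact hF.of_bilin (fun a b => inner ℝ a b) 1 (hDv n) (hF.1.inner (hDv n).1)
        (Eventually.of_forall fun x => by simpa using nnnorm_inner_le_nnnorm (𝕜 := ℝ) _ _)
    have key : Tendsto (fun n => ∫ x in (Ω : Set (Euc N)), inner ℝ (F x) (Dv n x)) atTop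
        (𝓝 (∫ x in (Ω : Set (Euc N)), inner ℝ (F x) (DV x))) := by
      refine tendsto_integral_of_L1' _ (hF.1.inner hDV.1) (Eventually.of_forall hint) ?_
      have h0 : Tendsto (fun n => (1 : NNReal) * eLpNorm F (ENNReal.ofReal (p / (p - 1)))
          (volume.restrict Ω) * eLpNorm (Dv n - DV) (ENNReal.ofReal p) (volume.restrict Ω))
          atTop (𝓝 0) := by
        have h := ENNReal.Tendsto.const_mul hlim
          (Or.inr (show (1 : NNReal) * eLpNorm F (ENNReal.ofReal (p / (p - 1)))
          (volume.restrict Ω) ≠ ∞ from by simpa using hF.2.ne))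
        simpa using h
      refine tendsto_of_tendsto_of_tendsto_of_le_of_le tendsto_const_nhds h0
        (fun _ => zero_le) fun n => ?_
      refine le_trans (le_of_eq ?_) (eLpNorm_le_eLpNorm_mul_eLpNorm_of_nnnorm (r := 1) hF.1
        ((hDv n).1.sub hDV.1) (fun a b => inner ℝ a b) 1
        (Eventually.of_forall fun x => by simpa using nnnorm_inner_le_nnnorm (𝕜 := ℝ) _ _))
      congr 1
      funext x
      simp [inner_sub_right]
    have hFi : ∀ x y, A x (u.toFun x) * ‖u.jac x‖ ^ (p - 2) * inner ℝ (u.jac x) y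
        = inner ℝ (F x) y := fun x y => by simp [F, inner_smul_left]
    simpa only [hFi] using key
  · refine tendsto_integral_of_dominated_convergence (fun x => C₀ * M * ‖u.jac x‖ ^ p)
      (fun n => (hgA.inner (hv n)).mul hjp.1) (hjp.const_mul _) (fun n => ?_) ?_
    · filter_upwards [ha1] with x hx
      rw [norm_mul, Real.norm_of_nonneg (Real.rpow_nonneg (norm_nonneg (u.jac x)) p)]
      gcongr
      exact (norm_inner_le_norm _ _).trans (mul_le_mul (hx _).2 (hvM n x) (norm_nonneg _)
        ((norm_nonneg _).trans (hx 0).2))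
    · filter_upwards [hvV] with x hx
      exact (tendsto_const_nhds.inner hx).mul_const _
  · refine tendsto_integral_of_dominated_convergence
      (fun x => ‖gradient (G x) (u.toFun x)‖ * M)
      (fun n => hgG.inner (hv n)) (hg.norm.mul_const _) (fun n => ?_) ?_
    · exact Eventually.of_forall fun x => (norm_inner_le_norm _ _).trans
        (mul_le_mul_of_nonneg_left (hvM n x) (norm_nonneg _))
    · filter_upwards [hvV] with x hx
      exact tendsto_const_nhds.inner hx

theorem IsSlowCutoff.norm_cutoffJac_le {N m : ℕ} {R δ M : ℝ} {ψ : Euc m → ℝ}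
    (h : IsSlowCutoff R δ M ψ) (s : Euc m) (X : Mat m N) :
    ‖cutoffJac ψ s X‖ ≤ (1 + δ) * ‖X‖ := by
  have h1 : ‖cutoffJac ψ s X - ψ s • X‖ ≤ δ * ‖X‖ :=
    (norm_cutoffJac_sub_le ψ s X).trans
      (mul_le_mul_of_nonneg_right (h.mul_norm_gradient_le s) (norm_nonneg _))
  have h2 : ‖ψ s • X‖ ≤ 1 * ‖X‖ := by
    rw [norm_smul, Real.norm_of_nonneg (h.nonneg s)]
    exact mul_le_mul_of_nonneg_right (h.le_one s) (norm_nonneg _)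
  have h3 := norm_add_le (cutoffJac ψ s X - ψ s • X) (ψ s • X)
  rw [sub_add_cancel] at h3
  linarith

theorem IsSlowCutoff.norm_smul_le {m : ℕ} {R δ M : ℝ} (hM : 0 < M) {ψ : Euc m → ℝ}
    (h : IsSlowCutoff R δ M ψ) (s : Euc m) : ‖ψ s • s‖ ≤ M := by
  by_cases hs : ψ s = 0
  · simpa [hs] using hM.le
  · rw [norm_smul, Real.norm_of_nonneg (h.nonneg s)]
    calc ψ s * ‖s‖ ≤ 1 * M :=
          mul_le_mul (h.le_one s) (h.norm_le s hs) (norm_nonneg _) zero_le_one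
      _ = M := one_mul M

theorem IsSlowCutoff.contDiff_one {m : ℕ} {R δ M : ℝ} {ψ : Euc m → ℝ}
    (h : IsSlowCutoff R δ M ψ) : ContDiff ℝ 1 ψ :=
  h.contDiff.of_le (by exact_mod_cast le_top)

/-- The test function `x ↦ ψ (w x) • w x`. -/
noncomputable def cutoffTest {N m : ℕ} {Ω : Opens (Euc N)} {ψ : Euc m → ℝ}
    (hψ : ContDiff ℝ ((⊤ : ℕ∞) : WithTop ℕ∞) ψ) (w : 𝓓(Ω, Euc m)) : 𝓓(Ω, Euc m) :=
  ⟨fun x => ψ (w x) • w x, (hψ.comp w.contDiff).smul w.contDiff,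
    w.hasCompactSupport.smul_left (f := fun x => ψ (w x)),
    (tsupport_smul_subset_right (fun x => ψ (w x)) w).trans w.tsupport_subset⟩

theorem SobolevZero.memLp_cutoffJac {N m : ℕ} {Ω : Opens (Euc N)} {p R δ M : ℝ}
    (u : SobolevZero Ω m p) {ψ : Euc m → ℝ} (hψ : IsSlowCutoff R δ M ψ) :
    MemLp (fun x => cutoffJac ψ (u.toFun x) (u.jac x)) (ENNReal.ofReal p)
      (volume.restrict Ω) := by
  have hc := continuous_cutoffJac (N := N) hψ.contDiff_one
  have hm : AEStronglyMeasurable (fun x => cutoffJac ψ (u.toFun x) (u.jac x))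
      (volume.restrict (Ω : Set (Euc N))) :=
    hc.comp_aestronglyMeasurable (f := fun x => (u.toFun x, u.jac x))
      (u.memLp.1.prodMk u.memLp_jac.1)
  exact MemLp.of_le_mul u.memLp_jac hm
    (Eventually.of_forall fun x => hψ.norm_cutoffJac_le (u.toFun x) (u.jac x))

/-- The Euler distribution extends to the bounded function `ψ(u) u`, with the bound given by its
dual norm. -/
theorem eulerForm_cutoff_le {N m : ℕ} {Ω : Opens (Euc N)}
    (hΩ : Bornology.IsBounded (Ω : Set (Euc N))) {p : ℝ} (hp : 1 < p)
    {A G : Euc N → Euc m → ℝ} (hA : IsC1Caratheodory Ω A) (hG : IsC1Caratheodory Ω G) {C₀ : ℝ}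
    (ha1 : ∀ᵐ x ∂(volume.restrict (Ω : Set (Euc N))), ∀ s : Euc m,
      |A x s| ≤ C₀ ∧ ‖gradient (A x) s‖ ≤ C₀)
    (u : SobolevZero Ω m p)
    (hg : IntegrableOn (fun x => gradient (G x) (u.toFun x)) (Ω : Set (Euc N)))
    (hfin : dualNorm Ω p (eulerDistribution A G u) < ∞)
    {R δ M : ℝ} (hM : 0 < M) {ψ : Euc m → ℝ} (hψ : IsSlowCutoff R δ M ψ) {B : ℝ} (hB : 0 < B)
    (hTB : eLpNorm (fun x => cutoffJac ψ (u.toFun x) (u.jac x)) (ENNReal.ofReal p)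
      (volume.restrict Ω) < ENNReal.ofReal B) :
    eulerForm A G u (fun x => ψ (u.toFun x) • u.toFun x)
        (fun x => cutoffJac ψ (u.toFun x) (u.jac x))
      ≤ (dualNorm Ω p (eulerDistribution A G u)).toReal * B := by
  have : IsFiniteMeasure (volume.restrict (Ω : Set (Euc N))) :=
    ⟨by simpa using hΩ.measure_lt_top⟩
  have hp1 : 1 ≤ ENNReal.ofReal p := by simpa using ENNReal.ofReal_le_ofReal hp.le
  obtain ⟨w, hw1, hw2, hw3, hw4⟩ := u.exists_tendsto hp
  set v : ℕ → 𝓓(Ω, Euc m) := fun n => cutoffTest hψ.contDiff (w n)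
  have hvj : ∀ n x, jacobian (v n) x = cutoffJac ψ (w n x) (jacobian (w n) x) := fun n x =>
    jacobian_cutoff (hψ.contDiff_one.differentiable one_ne_zero _)
      ((w n).contDiff_one.differentiable one_ne_zero x)
  have hvm : ∀ n, AEStronglyMeasurable (jacobian (v n)) (volume.restrict (Ω : Set (Euc N))) :=
    fun n => (continuous_jacobian (v n).contDiff_one).aestronglyMeasurable
  have hvle : ∀ n x, ‖jacobian (v n) x‖ ≤ (1 + δ) * ‖jacobian (w n) x‖ := fun n x => by
    rw [hvj]; exact hψ.norm_cutoffJac_le _ _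
  have hT := u.memLp_cutoffJac hψ
  have hae : ∀ᵐ x ∂(volume.restrict (Ω : Set (Euc N))), Tendsto (fun n => jacobian (v n) x) atTop
      (𝓝 (cutoffJac ψ (u.toFun x) (u.jac x))) := by
    have hc := continuous_cutoffJac (N := N) hψ.contDiff_one
    filter_upwards [hw3, hw4] with x h3 h4
    simp only [hvj]
    exact Tendsto.comp (f := fun n => (w n x, jacobian (w n) x))
      (hc.tendsto (u.toFun x, u.jac x)) (h3.prodMk_nhds h4)
  have hlim := tendsto_eLpNorm_of_norm_le_mul hp1 ENNReal.ofReal_ne_top hvm hT hw1 u.memLp_jac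
    hvle hw2 hae
  have hvae : ∀ᵐ x ∂(volume.restrict (Ω : Set (Euc N))), Tendsto (fun n => v n x) atTop
      (𝓝 (ψ (u.toFun x) • u.toFun x)) := by
    filter_upwards [hw3] with x h3
    exact ((hψ.contDiff.continuous.tendsto _).comp h3).smul h3
  have hvm' : ∀ n, MemLp (jacobian (v n)) (ENNReal.ofReal p)
      (volume.restrict (Ω : Set (Euc N))) := fun n =>
    MemLp.of_le_mul (hw1 n) (hvm n) (Eventually.of_forall (hvle n))
  have hE := tendsto_eulerForm hp hA hG ha1 u hg (v := fun n => v n)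
    (fun n => (v n).continuous.aestronglyMeasurable) (fun n x => hψ.norm_smul_le hM (w n x))
    hvae hvm' hT hlim
  refine le_of_tendsto hE ?_
  filter_upwards [hlim.eventually (gt_mem_nhds (tsub_pos_of_lt hTB))] with n hn
  refine (le_abs_self _).trans (abs_eulerDistribution_le A G u hfin hB (v n) ?_)
  have h1 := eLpNorm_add_le ((hvm n).sub hT.1) hT.1 hp1
  rw [sub_add_cancel] at h1
  refine h1.trans ((add_le_add_left hn.le _).trans_eq ?_)
  exact tsub_add_cancel_of_le hTB.le

theorem setIntegral_and_eq_integral_indicator {E : Type*} [NormedAddCommGroup E]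
    [MeasurableSpace E] [BorelSpace E] {μ : Measure E} {Ω : Opens E} {s : Set E}
    (hs : NullMeasurableSet s (μ.restrict (Ω : Set E))) (f : E → ℝ) :
    ∫ x in {x | x ∈ Ω ∧ x ∈ s}, f x ∂μ = ∫ x in (Ω : Set E), s.indicator f x ∂μ := by
  rw [integral_indicator₀ hs, Measure.restrict_restrict₀ hs]
  congr 2
  ext x
  exact and_comm

theorem rpow_sub_two_mul_mul_self {t : ℝ} (ht : 0 ≤ t) {p : ℝ} (hp : 0 < p) :
    t ^ (p - 2) * (t * t) = t ^ p := by
  rcases ht.eq_or_lt with h0 | h0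
  · rw [← h0, mul_zero, mul_zero, Real.zero_rpow hp.ne']
  · rw [← mul_assoc, ← Real.rpow_add_one h0.ne', ← Real.rpow_add_one h0.ne']
    congr 1; ring

theorem IsSlowCutoff.le_inner_cutoffJac {N m : ℕ} {R δ M : ℝ} {ψ : Euc m → ℝ}
    (h : IsSlowCutoff R δ M ψ) (s : Euc m) (X : Mat m N) :
    -(δ * (‖X‖ * ‖X‖)) ≤ inner ℝ X (cutoffJac ψ s X) := by
  have h1 : inner ℝ X (cutoffJac ψ s X)
      = ψ s * (‖X‖ * ‖X‖) + inner ℝ X (cutoffJac ψ s X - ψ s • X) := by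
    rw [inner_sub_right, inner_smul_right, real_inner_self_eq_norm_mul_norm]; ring
  have h2 := neg_le_of_abs_le (abs_real_inner_le_norm X (cutoffJac ψ s X - ψ s • X))
  have h3 : ‖cutoffJac ψ s X - ψ s • X‖ ≤ δ * ‖X‖ :=
    (norm_cutoffJac_sub_le ψ s X).trans
      (mul_le_mul_of_nonneg_right (h.mul_norm_gradient_le s) (norm_nonneg _))
  have h4 := mul_le_mul_of_nonneg_left h3 (norm_nonneg X)
  have h5 := mul_nonneg (h.nonneg s) (mul_self_nonneg ‖X‖)
  rw [h1]
  linarith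

theorem IsSlowCutoff.cutoffJac_eq {N m : ℕ} {R δ M : ℝ} {ψ : Euc m → ℝ}
    (h : IsSlowCutoff R δ M ψ) {s : Euc m} (hs : ‖s‖ ≤ R) (X : Mat m N) :
    cutoffJac ψ s X = X := by
  have h1 := norm_cutoffJac_sub_le ψ s X
  rw [h.gradient_eq_zero hs, norm_zero, mul_zero, zero_mul, h.eq_one s hs, one_smul] at h1
  exact sub_eq_zero.1 (norm_le_zero_iff.1 h1)

theorem SobolevZero.integrable_norm_jac_rpow {N m : ℕ} {Ω : Opens (Euc N)} {p : ℝ} (hp : 0 < p)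
    (u : SobolevZero Ω m p) : IntegrableOn (fun x => ‖u.jac x‖ ^ p) (Ω : Set (Euc N)) := by
  have h := u.memLp_jac.integrable_norm_rpow (by simpa using hp) (by simp)
  rw [ENNReal.toReal_ofReal hp.le] at h
  exact h

theorem SobolevZero.integrable_mul_norm_jac_rpow {N m : ℕ} {Ω : Opens (Euc N)} {p : ℝ}
    (hp : 0 < p) (u : SobolevZero Ω m p) {A : Euc N → Euc m → ℝ} (hA : IsC1Caratheodory Ω A)
    {C₀ : ℝ} (ha1 : ∀ᵐ x ∂(volume.restrict (Ω : Set (Euc N))), ∀ s : Euc m, |A x s| ≤ C₀) :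
    IntegrableOn (fun x => A x (u.toFun x) * ‖u.jac x‖ ^ p) (Ω : Set (Euc N)) :=
  (u.integrable_norm_jac_rpow hp).bdd_mul (hA.aestronglyMeasurable_comp u.memLp.1)
    (ha1.mono fun _ hx => hx _)

/-- Lower bound for the Euler form at `ψ(u) u`. -/
theorem le_eulerForm_cutoff {N m : ℕ} {Ω : Opens (Euc N)}
    (hΩ : Bornology.IsBounded (Ω : Set (Euc N))) {p : ℝ} (hp : 1 < p)
    {A G : Euc N → Euc m → ℝ} (hA : IsC1Caratheodory Ω A) {C₀ : ℝ}
    (ha1 : ∀ᵐ x ∂(volume.restrict (Ω : Set (Euc N))), ∀ s : Euc m, |A x s| ≤ C₀)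
    (ha2 : ∀ᵐ x ∂(volume.restrict (Ω : Set (Euc N))), ∀ s : Euc m, 0 ≤ A x s)
    (ha3 : ∀ᵐ x ∂(volume.restrict (Ω : Set (Euc N))), ∀ s : Euc m,
      0 ≤ inner ℝ s (gradient (A x) s))
    {q : ℝ} (hq : 1 ≤ q) {a : Euc N → ℝ} (ha : IntegrableOn a (Ω : Set (Euc N))) {b : ℝ}
    (hb : 0 ≤ b)
    (hg1 : ∀ᵐ x ∂(volume.restrict (Ω : Set (Euc N))), ∀ s : Euc m,
      ‖gradient (G x) s‖ ≤ a x + b * ‖s‖ ^ (q - 1))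
    (u : SobolevZero Ω m p)
    {R δ M : ℝ} (hδ : 0 < δ) (hM : 0 < M) {ψ : Euc m → ℝ} (hψ : IsSlowCutoff R δ M ψ) :
    (∫ x in {x | x ∈ Ω ∧ ‖u.toFun x‖ ≤ R}, A x (u.toFun x) * ‖u.jac x‖ ^ p)
      - δ * (∫ x in {x | x ∈ Ω ∧ R ≤ ‖u.toFun x‖}, A x (u.toFun x) * ‖u.jac x‖ ^ p)
      - (∫ x in (Ω : Set (Euc N)), (|a x| + b * M ^ (q - 1)) * M)
      ≤ eulerForm A G u (fun x => ψ (u.toFun x) • u.toFun x)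
        (fun x => cutoffJac ψ (u.toFun x) (u.jac x)) := by
  have hp0 : 0 < p := by linarith
  have : IsFiniteMeasure (volume.restrict (Ω : Set (Euc N))) :=
    ⟨by simpa using hΩ.measure_lt_top⟩
  set P : Euc N → ℝ := fun x => A x (u.toFun x) * ‖u.jac x‖ ^ p with hP
  have hPi : Integrable P (volume.restrict (Ω : Set (Euc N))) :=
    u.integrable_mul_norm_jac_rpow hp0 hA ha1
  set S₁ : Set (Euc N) := {x | ‖u.toFun x‖ ≤ R}
  set S₂ : Set (Euc N) := {x | R ≤ ‖u.toFun x‖}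
  have hS₁ : NullMeasurableSet S₁ (volume.restrict (Ω : Set (Euc N))) :=
    nullMeasurableSet_le u.memLp.1.norm.aemeasurable aemeasurable_const
  have hS₂ : NullMeasurableSet S₂ (volume.restrict (Ω : Set (Euc N))) :=
    nullMeasurableSet_le aemeasurable_const u.memLp.1.norm.aemeasurable
  have e1 : ∫ x in {x | x ∈ Ω ∧ ‖u.toFun x‖ ≤ R}, P x
      = ∫ x in (Ω : Set (Euc N)), S₁.indicator P x := setIntegral_and_eq_integral_indicator hS₁ P
  have e2 : ∫ x in {x | x ∈ Ω ∧ R ≤ ‖u.toFun x‖}, P x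
      = ∫ x in (Ω : Set (Euc N)), S₂.indicator P x := setIntegral_and_eq_integral_indicator hS₂ P
  have hT := u.memLp_cutoffJac hψ
  have hf1 : Integrable (fun x => A x (u.toFun x) * ‖u.jac x‖ ^ (p - 2)
      * inner ℝ (u.jac x) (cutoffJac ψ (u.toFun x) (u.jac x)))
      (volume.restrict (Ω : Set (Euc N))) := by
    refine (hPi.const_mul (1 + δ)).mono' (((hA.aestronglyMeasurable_comp u.memLp.1).mul
      (u.memLp_jac.1.norm.aemeasurable.pow_const _).aestronglyMeasurable).mul
        (u.memLp_jac.1.inner hT.1)) ?_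
    filter_upwards [ha2] with x hx
    have h1 : ‖inner ℝ (u.jac x) (cutoffJac ψ (u.toFun x) (u.jac x))‖
        ≤ ‖u.jac x‖ * ((1 + δ) * ‖u.jac x‖) :=
      (norm_inner_le_norm _ _).trans
        (mul_le_mul_of_nonneg_left (hψ.norm_cutoffJac_le _ _) (norm_nonneg _))
    have h2 : 0 ≤ A x (u.toFun x) * ‖u.jac x‖ ^ (p - 2) := mul_nonneg (hx _) (by positivity)
    rw [norm_mul, Real.norm_of_nonneg h2]
    refine (mul_le_mul_of_nonneg_left h1 h2).trans_eq ?_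
    simp only [hP, ← rpow_sub_two_mul_mul_self (norm_nonneg (u.jac x)) hp0]
    ring
  have t1 : (∫ x in (Ω : Set (Euc N)), S₁.indicator P x)
      - δ * (∫ x in (Ω : Set (Euc N)), S₂.indicator P x) ≤
      ∫ x in (Ω : Set (Euc N)), A x (u.toFun x) * ‖u.jac x‖ ^ (p - 2)
        * inner ℝ (u.jac x) (cutoffJac ψ (u.toFun x) (u.jac x)) := by
    have i1 := hPi.indicator₀ hS₁
    have i2 := (hPi.indicator₀ hS₂).const_mul δ
    rw [← integral_const_mul, ← integral_sub i1 i2]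
    refine integral_mono_ae (i1.sub i2) hf1 ?_
    filter_upwards [ha2] with x hx
    have hPx : 0 ≤ P x := mul_nonneg (hx _) (by positivity)
    have h2 : 0 ≤ A x (u.toFun x) * ‖u.jac x‖ ^ (p - 2) := mul_nonneg (hx _) (by positivity)
    have h3 : A x (u.toFun x) * ‖u.jac x‖ ^ (p - 2) * (‖u.jac x‖ * ‖u.jac x‖) = P x := by
      rw [mul_assoc, rpow_sub_two_mul_mul_self (norm_nonneg _) hp0]
    by_cases h : ‖u.toFun x‖ ≤ R
    · rw [hψ.cutoffJac_eq h, real_inner_self_eq_norm_mul_norm, h3,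
        Set.indicator_of_mem (show x ∈ S₁ from h)]
      have : 0 ≤ δ * S₂.indicator P x :=
        mul_nonneg hδ.le (Set.indicator_apply_nonneg fun _ => hPx)
      linarith
    · rw [Set.indicator_of_notMem (show x ∉ S₁ from h),
        Set.indicator_of_mem (show x ∈ S₂ from (not_le.1 h).le), ← h3]
      have := mul_le_mul_of_nonneg_left (hψ.le_inner_cutoffJac (u.toFun x) (u.jac x)) h2
      linarith
  have t2 : 0 ≤ ∫ x in (Ω : Set (Euc N)),
      inner ℝ (gradient (A x) (u.toFun x)) (ψ (u.toFun x) • u.toFun x) * ‖u.jac x‖ ^ p := by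
    refine integral_nonneg_of_ae ?_
    filter_upwards [ha3] with x hx
    have := hx (u.toFun x)
    rw [real_inner_comm] at this
    have h0 := hψ.nonneg (u.toFun x)
    simp only [inner_smul_right, Pi.zero_apply]
    positivity
  have t3 : ‖∫ x in (Ω : Set (Euc N)),
      inner ℝ (gradient (G x) (u.toFun x)) (ψ (u.toFun x) • u.toFun x)‖
      ≤ ∫ x in (Ω : Set (Euc N)), (|a x| + b * M ^ (q - 1)) * M := by
    refine norm_integral_le_of_norm_le ((ha.abs.add (integrable_const _)).mul_const _) ?_
    filter_upwards [hg1] with x hx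
    refine (norm_inner_le_norm _ _).trans ?_
    by_cases h : ψ (u.toFun x) = 0
    · rw [h, zero_smul, norm_zero, mul_zero]
      positivity
    · refine mul_le_mul ((hx _).trans ?_) (hψ.norm_smul_le hM _) (norm_nonneg _) (by positivity)
      refine add_le_add (le_abs_self _) (mul_le_mul_of_nonneg_left ?_ hb)
      exact Real.rpow_le_rpow (norm_nonneg _) (hψ.norm_le _ h) (by linarith)
  have t3' := (le_abs_self _).trans t3
  have t2' := mul_nonneg (one_div_nonneg.2 hp0.le) t2
  rw [e1, e2]
  simp only [eulerForm]
  linarith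

theorem exists_mul_le_mul_rpow_add {D δ p : ℝ} (hD : 0 ≤ D) (hδ : 0 < δ) (hp : 1 < p) :
    ∃ C : ℝ, 0 ≤ C ∧ ∀ t : ℝ, 0 ≤ t → D * t ≤ δ * t ^ p + C := by
  refine ⟨D * (D / δ) ^ (p - 1)⁻¹, by positivity, fun t ht => ?_⟩
  have hp1 : 0 < p - 1 := by linarith
  have htp : t ^ (p - 1) * t = t ^ p := by
    rcases ht.eq_or_lt with h0 | h0
    · rw [← h0, mul_zero, Real.zero_rpow (by linarith)]
    · rw [← Real.rpow_add_one h0.ne']; congr 1; ring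
  rcases le_total D (δ * t ^ (p - 1)) with h | h
  · calc D * t ≤ δ * t ^ (p - 1) * t := by gcongr
      _ = δ * t ^ p := by rw [mul_assoc, htp]
      _ ≤ _ := le_add_of_nonneg_right (by positivity)
  · have h1 : t ≤ (D / δ) ^ (p - 1)⁻¹ := by
      rw [Real.le_rpow_inv_iff_of_pos ht (by positivity) hp1, le_div_iff₀ hδ, mul_comm]
      exact h
    calc D * t ≤ D * (D / δ) ^ (p - 1)⁻¹ := by gcongr
      _ ≤ _ := le_add_of_nonneg_left (by positivity)

theorem exists_forall_toReal_le_of_tendsto_zero {f : ℕ → ℝ≥0∞}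
    (h : Tendsto f atTop (𝓝 0)) : ∃ D : ℝ, 0 ≤ D ∧ ∀ n, (f n).toReal ≤ D := by
  have h1 : Tendsto (fun n => (f n).toReal) atTop (𝓝 (0 : ℝ≥0∞).toReal) :=
    (ENNReal.tendsto_toReal ENNReal.zero_ne_top).comp h
  obtain ⟨D, hD⟩ := h1.bddAbove_range
  have hD' : ∀ n, (f n).toReal ≤ D := fun n => hD ⟨n, rfl⟩
  exact ⟨D, ENNReal.toReal_nonneg.trans (hD' 0), hD'⟩

theorem SobolevZero.toReal_eLpNorm_jac_rpow {N m : ℕ} {Ω : Opens (Euc N)} {p : ℝ} (hp : 0 < p)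
    (u : SobolevZero Ω m p) :
    (eLpNorm u.jac (ENNReal.ofReal p) (volume.restrict Ω)).toReal ^ p
      = ∫ x in (Ω : Set (Euc N)), ‖u.jac x‖ ^ p := by
  have h0 : 0 ≤ ∫ x in (Ω : Set (Euc N)), ‖u.jac x‖ ^ p :=
    integral_nonneg fun x => by positivity
  rw [u.memLp_jac.eLpNorm_eq_integral_rpow_norm (by simpa using hp) (by simp),
    ENNReal.toReal_ofReal hp.le, ENNReal.toReal_ofReal (by positivity),
    Real.rpow_inv_rpow h0 hp.ne']

theorem integral_le_setIntegral_add {N m : ℕ} {Ω : Opens (Euc N)} {p R : ℝ}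
    (u : SobolevZero Ω m p) {f : Euc N → ℝ} (hf : IntegrableOn f (Ω : Set (Euc N)))
    (h0 : ∀ᵐ x ∂(volume.restrict (Ω : Set (Euc N))), 0 ≤ f x) :
    ∫ x in (Ω : Set (Euc N)), f x ≤ (∫ x in {x | x ∈ Ω ∧ ‖u.toFun x‖ ≤ R}, f x)
      + ∫ x in {x | x ∈ Ω ∧ R ≤ ‖u.toFun x‖}, f x := by
  have hS₁ : NullMeasurableSet {x | ‖u.toFun x‖ ≤ R} (volume.restrict (Ω : Set (Euc N))) :=
    nullMeasurableSet_le u.memLp.1.norm.aemeasurable aemeasurable_const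
  have hS₂ : NullMeasurableSet {x | R ≤ ‖u.toFun x‖} (volume.restrict (Ω : Set (Euc N))) :=
    nullMeasurableSet_le aemeasurable_const u.memLp.1.norm.aemeasurable
  have e1 := setIntegral_and_eq_integral_indicator hS₁ f
  have e2 := setIntegral_and_eq_integral_indicator hS₂ f
  simp only [Set.mem_ofPred_eq] at e1 e2
  have i1 := hf.indicator₀ hS₁
  have i2 := hf.indicator₀ hS₂
  rw [e1, e2, ← integral_add i1 i2]
  refine integral_mono_ae hf (i1.add i2) ?_
  filter_upwards [h0] with x hx
  have n1 := Set.indicator_apply_nonneg (s := {x | ‖u.toFun x‖ ≤ R}) (f := f) (a := x)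
    fun _ => hx
  have n2 := Set.indicator_apply_nonneg (s := {x | R ≤ ‖u.toFun x‖}) (f := f) (a := x)
    fun _ => hx
  rcases le_total ‖u.toFun x‖ R with h | h
  · rw [Set.indicator_of_mem (show x ∈ {x | ‖u.toFun x‖ ≤ R} from h)]
    linarith
  · rw [Set.indicator_of_mem (show x ∈ {x | R ≤ ‖u.toFun x‖} from h)]
    linarith

theorem SobolevZero.integrable_gradient_comp {N m : ℕ} {Ω : Opens (Euc N)} (hN : 1 < N) {p : ℝ}
    (hp : 1 < p) (hΩ : Bornology.IsBounded (Ω : Set (Euc N))) {G : Euc N → Euc m → ℝ}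
    (hG : IsC1Caratheodory Ω G) {q : ℝ} (hq1 : 1 < q) (hq : p < N → q < N * p / (N - p))
    {a : Euc N → ℝ} (ha : IntegrableOn a (Ω : Set (Euc N))) {b : ℝ}
    (hg1 : ∀ᵐ x ∂(volume.restrict (Ω : Set (Euc N))), ∀ s : Euc m,
      ‖gradient (G x) s‖ ≤ a x + b * ‖s‖ ^ (q - 1)) (u : SobolevZero Ω m p) :
    IntegrableOn (fun x => gradient (G x) (u.toFun x)) (Ω : Set (Euc N)) := by
  have : IsFiniteMeasure (volume.restrict (Ω : Set (Euc N))) :=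
    ⟨by simpa using hΩ.measure_lt_top⟩
  have h1 : MemLp u.toFun (ENNReal.ofReal (q - 1)) (volume.restrict Ω) :=
    (u.memLp_of_lt_critical hN hp hΩ hq1 hq).mono_exponent
      (ENNReal.ofReal_le_ofReal (by linarith))
  have h2 := h1.integrable_norm_rpow'
  rw [ENNReal.toReal_ofReal (by linarith)] at h2
  exact (ha.add (h2.const_mul b)).mono' (hG.aestronglyMeasurable_gradient_comp u.memLp.1)
    (hg1.mono fun x hx => hx _)

theorem proposition4p1 {N m : ℕ} (hN : 1 < N) {p : ℝ} (hp : 1 < p)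
    (Ω : Opens (Euc N)) (hΩ_conn : IsConnected (Ω : Set (Euc N)))
    (hΩ_bdd : Bornology.IsBounded (Ω : Set (Euc N)))
    -- the coefficient `A`
    (A : Euc N → Euc m → ℝ) (hA : IsC1Caratheodory Ω A)
    (C₀ : ℝ)
    (ha1 : ∀ᵐ x ∂(volume.restrict (Ω : Set (Euc N))), ∀ s : Euc m,
      |A x s| ≤ C₀ ∧ ‖gradient (A x) s‖ ≤ C₀)
    (ν₀ : ℝ) (hν₀ : 0 < ν₀)
    (ha2 : ∀ᵐ x ∂(volume.restrict (Ω : Set (Euc N))), ∀ s : Euc m, ν₀ ≤ A x s)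
    (ha3 : ∀ᵐ x ∂(volume.restrict (Ω : Set (Euc N))), ∀ s : Euc m,
      0 ≤ inner ℝ s (gradient (A x) s))
    -- the nonlinearity `G`, with `g = ∇ₛG`
    (G : Euc N → Euc m → ℝ) (hG : IsC1Caratheodory Ω G)
    (hG0 : ∀ᵐ x ∂(volume.restrict (Ω : Set (Euc N))), G x 0 = 0 ∧ gradient (G x) 0 = 0)
    (r : ℝ≥0∞) (hr : (if p < N then ENNReal.ofReal (N * p / (N * p - N + p)) else 1) ≤ r)
    (q : ℝ) (hpq : p < q) (hq : p < N → q < N * p / (N - p))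
    (a : Euc N → ℝ) (ha : MemLp a r (volume.restrict (Ω : Set (Euc N))))
    (b : ℝ) (hb : 0 ≤ b)
    (hg1 : ∀ᵐ x ∂(volume.restrict (Ω : Set (Euc N))), ∀ s : Euc m,
      ‖gradient (G x) s‖ ≤ a x + b * ‖s‖ ^ (q - 1))
    -- the Concrete Palais-Smale sequence
    (c : ℝ) (u : ℕ → SobolevZero Ω m p) (hu : IsCPS A G c u) :
    ∀ R : ℝ, 0 < R → ∀ ε : ℝ, 0 < ε → ∃ K : ℝ, 0 < K ∧ ∀ n : ℕ,
      ∫ x in {x | x ∈ Ω ∧ ‖(u n).toFun x‖ ≤ R}, A x ((u n).toFun x) * ‖(u n).jac x‖ ^ p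
        ≤ ε * (∫ x in {x | x ∈ Ω ∧ R ≤ ‖(u n).toFun x‖},
            A x ((u n).toFun x) * ‖(u n).jac x‖ ^ p) + K := by
  intro R hR ε hε
  have hp0 : 0 < p := by linarith
  have hN0 : (0 : ℝ) < N := by exact_mod_cast (zero_lt_one.trans hN)
  have : IsFiniteMeasure (volume.restrict (Ω : Set (Euc N))) :=
    ⟨by simpa using hΩ_bdd.measure_lt_top⟩
  have hr1 : 1 ≤ r := by
    refine le_trans ?_ hr
    split_ifs with h
    · rw [ENNReal.one_le_ofReal, one_le_div (by nlinarith)]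
      linarith
    · exact le_rfl
  have haI : IntegrableOn a (Ω : Set (Euc N)) := ha.integrable hr1
  have hA1 := ha1.mono fun x hx s => (hx s).1
  have hA2 := ha2.mono fun x hx s => hν₀.le.trans (hx s)
  obtain ⟨D, hD0, hD⟩ := exists_forall_toReal_le_of_tendsto_zero hu.tendsto_dual
  set δ : ℝ := min 1 (min (ν₀ / 2) (ε / (2 * (1 + 1 / ν₀)))) with hδ_def
  have hδ : 0 < δ := by positivity
  have hδ1 : δ ≤ 1 := min_le_left _ _
  have hδ2 : δ / ν₀ ≤ 1 / 2 := by
    have : δ ≤ ν₀ / 2 := (min_le_right _ _).trans (min_le_left _ _)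
    rw [div_le_iff₀ hν₀]; linarith
  have hδ3 : 2 * (δ + δ / ν₀) ≤ ε := by
    have h : δ ≤ ε / (2 * (1 + 1 / ν₀)) := (min_le_right _ _).trans (min_le_right _ _)
    rw [le_div_iff₀ (by positivity)] at h
    calc 2 * (δ + δ / ν₀) = δ * (2 * (1 + 1 / ν₀)) := by ring
      _ ≤ ε := h
  obtain ⟨M, ψ, hM, hψ⟩ := exists_isSlowCutoff m hR hδ
  obtain ⟨C, hC0, hC⟩ := exists_mul_le_mul_rpow_add (D := 2 * D) (by positivity) hδ hp
  set K₁ : ℝ := ∫ x in (Ω : Set (Euc N)), (|a x| + b * M ^ (q - 1)) * M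
  have hK₁ : 0 ≤ K₁ := integral_nonneg fun x => by positivity
  refine ⟨2 * (K₁ + D + C) + 1, by positivity, fun n => ?_⟩
  set E₁ := ∫ x in {x | x ∈ Ω ∧ ‖(u n).toFun x‖ ≤ R}, A x ((u n).toFun x) * ‖(u n).jac x‖ ^ p
  set E₂ := ∫ x in {x | x ∈ Ω ∧ R ≤ ‖(u n).toFun x‖}, A x ((u n).toFun x) * ‖(u n).jac x‖ ^ p
    with hE₂
  have hPi := (u n).integrable_mul_norm_jac_rpow hp0 hA hA1
  have hP0 : ∀ᵐ x ∂(volume.restrict (Ω : Set (Euc N))),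
      0 ≤ A x ((u n).toFun x) * ‖(u n).jac x‖ ^ p :=
    hA2.mono fun x hx => mul_nonneg (hx _) (by positivity)
  have hE₂0 : 0 ≤ E₂ :=
    integral_nonneg_of_ae (ae_mono (Measure.restrict_mono (fun x hx => hx.1) le_rfl) hP0)
  set L := (eLpNorm (u n).jac (ENNReal.ofReal p) (volume.restrict Ω)).toReal
  have hL0 : 0 ≤ L := ENNReal.toReal_nonneg
  have hLp : ν₀ * L ^ p ≤ E₁ + E₂ := by
    refine le_trans ?_ (integral_le_setIntegral_add (R := R) (u n) hPi hP0)
    rw [(u n).toReal_eLpNorm_jac_rpow hp0, ← integral_const_mul]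
    refine integral_mono_ae (((u n).integrable_norm_jac_rpow hp0).const_mul _) hPi ?_
    filter_upwards [ha2] with x hx
    exact mul_le_mul_of_nonneg_right (hx _) (by positivity)
  have hTB : eLpNorm (fun x => cutoffJac ψ ((u n).toFun x) ((u n).jac x)) (ENNReal.ofReal p)
      (volume.restrict Ω) < ENNReal.ofReal (2 * L + 1) := by
    have h1 : eLpNorm (fun x => cutoffJac ψ ((u n).toFun x) ((u n).jac x)) (ENNReal.ofReal p)
        (volume.restrict Ω) ≤ ENNReal.ofReal 2
          * eLpNorm (u n).jac (ENNReal.ofReal p) (volume.restrict Ω) :=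
      eLpNorm_le_mul_eLpNorm_of_ae_le_mul (Eventually.of_forall fun x =>
        (hψ.norm_cutoffJac_le _ _).trans
          (mul_le_mul_of_nonneg_right (by linarith) (norm_nonneg _))) _
    refine h1.trans_lt ?_
    rw [← ENNReal.ofReal_toReal (u n).memLp_jac.2.ne, ← ENNReal.ofReal_mul (by norm_num)]
    exact (ENNReal.ofReal_lt_ofReal_iff (by positivity)).2 (lt_add_one _)
  have hgI := (u n).integrable_gradient_comp hN hp hΩ_bdd hG (hp.trans hpq) hq haI hg1
  have hup := eulerForm_cutoff_le hΩ_bdd hp hA hG ha1 (u n) hgI (hu.mem_dual n) hM hψ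
    (by positivity : 0 < 2 * L + 1) hTB
  have hlow := le_eulerForm_cutoff hΩ_bdd hp hA hA1 hA2 ha3 (hp.trans hpq).le haI hb hg1 (u n)
    hδ hM hψ
  have h1 : (dualNorm Ω p (eulerDistribution A G (u n))).toReal * (2 * L + 1)
      ≤ D * (2 * L + 1) := mul_le_mul_of_nonneg_right (hD n) (by positivity)
  have h2 := hC L hL0
  have h3 : δ * L ^ p ≤ δ / ν₀ * (E₁ + E₂) := by
    calc δ * L ^ p = δ / ν₀ * (ν₀ * L ^ p) := by field_simp
      _ ≤ _ := mul_le_mul_of_nonneg_left hLp (by positivity)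
  have hmain : E₁ - δ * E₂ - K₁ ≤ D + C + δ / ν₀ * (E₁ + E₂) := by
    linarith [hlow.trans hup]
  have h6 : 2 * (δ + δ / ν₀) * E₂ ≤ ε * E₂ := mul_le_mul_of_nonneg_right hδ3 hE₂0
  rcases le_total E₁ 0 with hneg | hpos
  · have : 0 ≤ ε * E₂ := by positivity
    linarith
  · have h7 : δ / ν₀ * E₁ ≤ 1 / 2 * E₁ := mul_le_mul_of_nonneg_right hδ2 hpos
    linarith
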